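/- All spaces $C(K)$ consist of real-valued functions with the supremum norm. A bounded operator is weakly compact if the image of the unit ball is relatively weakly compact. An operator $T$ on $C(L)$, $L$ compact Hausdorff, is a weak multiplier if its adjoint on $C(L)^*=M(L)$ (the signed Radon measures on $L$) has the form $T^*=g\,\mathrm{Id}+S$, where $g:L\to\mathbb{R}$ is integrable with respect to every Radon measure on $L$, $g\,\mathrm{Id}$ denotes the map $\mu\mapsto g\mu$, and $S$ is weakly compact on $C(L)^*$. A real Banach space $E$ is extremely non-complex if $\|\mathrm{Id}+T^2\|=1+\|T^2\|$ for every bounded operator $T:E\to E$. Let $(K_i)_{i\in\mathbb{N}}$ be a family of perfect compact Hausdorff spaces (that is, without isolated points) such that for each $i$ every bounded operator on $C(K_i)$ is a weak multiplier. Let $K$ be a nonempty compact Hausdorff space that is a compactification of the topological disjoint union $\bigcup_{i\in\mathbb{N}}K_i$, i.e. this union is (homeomorphic to) an open dense subset of $K$, and put $K_{-i}=K\setminus K_i$. Suppose that for each $i\in\mathbb{N}$, every bounded operator $C(K_i)\to C(K_{-i})$ is weakly compact, or every bounded operator $C(K_{-i})\to C(K_i)$ is weakly compact. Then $C(K)$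 is extremely non-complex. -/

import Mathlib

open MeasureTheory TopologicalSpace

/-- A bounded operator between real normed spaces is weakly compact if the image of the closed
unit ball is relatively compact for the weak topology of the codomain. -/
def IsWeaklyCompactOperator {E F : Type*} [NormedAddCommGroup E] [NormedSpace ℝ E]
    [NormedAddCommGroup F] [NormedSpace ℝ F] (T : E →L[ℝ] F) : Prop :=
  IsCompact (closure (toWeakSpace ℝ F '' (T '' Metric.closedBall (0 : E) 1)))

/-- A real normed space `E` is extremely non-complex if `‖Id + T²‖ = 1 + ‖T²‖` for every bounded
operator `T` on `E`. -/
def IsExtremelyNonComplex (E : Type*) [NormedAddCommGroup E] [NormedSpace ℝ E] : Prop :=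
  ∀ T : E →L[ℝ] E,
    ‖ContinuousLinearMap.id ℝ E + T.comp T‖ = 1 + ‖T.comp T‖

/-- The Banach-space adjoint `T* : E* → E*`, `T* φ = φ ∘ T`. -/
noncomputable def banachAdjoint {E : Type*} [NormedAddCommGroup E] [NormedSpace ℝ E]
    (T : E →L[ℝ] E) : StrongDual ℝ E →L[ℝ] StrongDual ℝ E :=
  ContinuousLinearMap.precomp ℝ T

/-- `G = g Id` on `C(X)* = M(X)`: the functional `φ` given by a signed Radon measure is sent to the
functional given by that measure multiplied by `g`. A signed Radon measure is written as
`μ - ν` with `μ`, `ν` finite, positive and regular; every `φ ∈ C(X)*` arises in this way. -/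
def IsMultiplicationBy {X : Type*} [TopologicalSpace X] [CompactSpace X] [MeasurableSpace X]
    (g : X → ℝ) (G : StrongDual ℝ C(X, ℝ) →L[ℝ] StrongDual ℝ C(X, ℝ)) : Prop :=
  ∀ (φ : StrongDual ℝ C(X, ℝ)) (μ ν : Measure X), IsFiniteMeasure μ → μ.Regular →
    IsFiniteMeasure ν → ν.Regular →
    (∀ f : C(X, ℝ), φ f = ∫ x, f x ∂μ - ∫ x, f x ∂ν) →
    ∀ f : C(X, ℝ), G φ f = ∫ x, f x * g x ∂μ - ∫ x, f x * g x ∂ν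

/-- `T` on `C(X)` is a weak multiplier if `T* = g Id + S` on `C(X)*`, where `g : X → ℝ` is
integrable with respect to every Radon measure and `S` is a weakly compact operator on `C(X)*`. -/
def IsWeakMultiplier {X : Type*} [TopologicalSpace X] [CompactSpace X] [MeasurableSpace X]
    (T : C(X, ℝ) →L[ℝ] C(X, ℝ)) : Prop :=
  ∃ g : X → ℝ, (∀ μ : Measure X, IsFiniteMeasure μ → μ.Regular → Integrable g μ) ∧
    ∃ G S : StrongDual ℝ C(X, ℝ) →L[ℝ] StrongDual ℝ C(X, ℝ),
      IsMultiplicationBy g G ∧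
      IsWeaklyCompactOperator (E := StrongDual ℝ C(X, ℝ)) (F := StrongDual ℝ C(X, ℝ)) S ∧
      banachAdjoint T = G + S

/-- `K` (to be used for `K` compact Hausdorff) as a compactification of the topological disjoint
union of the spaces `X i`: that union is embedded in `K` as an open dense subset. -/
structure CompactificationOfUnion (X : ℕ → Type*) [∀ i, TopologicalSpace (X i)]
    (K : Type*) [TopologicalSpace K] where
  /-- the embedding of the disjoint union -/
  emb : (Σ i, X i) → K
  isOpenEmbedding : Topology.IsOpenEmbedding emb
  denseRange : DenseRange emb

/-- The clopen set `K_{-i} = K \ K_i`, where `K_i` is the copy of `X i` in `K`. -/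
def CompactificationOfUnion.coPiece {X : ℕ → Type*} [∀ i, TopologicalSpace (X i)]
    [∀ i, CompactSpace (X i)] {K : Type*} [TopologicalSpace K] [T2Space K]
    (c : CompactificationOfUnion X K) (i : ℕ) : Clopens K where
  carrier := (Set.range fun x : X i => c.emb ⟨i, x⟩)ᶜ
  isClopen' := by
    have hcont : Continuous fun x : X i => c.emb ⟨i, x⟩ :=
      c.isOpenEmbedding.continuous.comp continuous_sigmaMk
    have hopen : IsOpenMap fun x : X i => c.emb ⟨i, x⟩ :=
      c.isOpenEmbedding.isOpenMap.comp isOpenMap_sigmaMk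
    exact IsClopen.compl ⟨(isCompact_range hcont).isClosed, hopen.isOpen_range⟩

instance Clopens.instCompactSpaceCoe {K : Type*} [TopologicalSpace K] [CompactSpace K]
    (U : Clopens K) : CompactSpace U :=
  isCompact_iff_compactSpace.mp U.isClopen.isClosed.isCompact

/-! For `A = T²`, the criterion `norm_id_add_eq_of_forall_exists` asks for a point `x` of a given
open set `U` and a perturbation `v` such that `f + v` stays in the unit ball, equals `1` at `x`, and
`A v x` is almost nonnegative. By density `U` meets some `K_i`. Perfectness gives disjoint bumps `u
n` there with peaks `x n`, and the candidates are `w n = u n * (1 - f)`. In the splitting `C(K) =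
C(K_i) ⊕ C(K_{-i})`, the `K_i`-corner of `T²` is `R² + BA`. One factor of `BA` is weakly compact, so
`BA (w n) (x n) → 0`. As `R* = g Id + S`, evaluation at `x n` is an eigenvector of `g Id`, and `R²
(w n) (x n)` is `g(x n)² * w n (x n)` up to a null sequence. Squaring makes this main term
nonnegative. Both null limits rest on the fact that weakly compact operators annihilate weakly
unconditionally Cauchy (wuC) series asymptotically, proved through Rosenthal's lemma. -/

open Filter Topology

/-! ### Combinatorics of infinite matrices. -/

/-- Rosenthal's disjointness lemma, with the bound on the row sums given as a multiple of `δ`. -/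
theorem rosenthal_of_le_nsmul {δ : ℝ} (hδ : 0 ≤ δ) (k : ℕ) :
    ∀ a : ℕ → ℕ → ℝ, (∀ n m, 0 ≤ a n m) →
      (∀ n (s : Finset ℕ), ∑ m ∈ s, a n m ≤ k * δ) →
      ∃ σ : ℕ → ℕ, Function.Injective σ ∧
        ∀ n (s : Finset ℕ), n ∉ s → ∑ m ∈ s, a (σ n) (σ m) ≤ δ := by
  induction k with
  | zero =>
    intro a _ hs
    refine ⟨id, Function.injective_id, fun n s _ => ?_⟩
    have := hs n s
    simp only [Nat.cast_zero, zero_mul] at this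
    exact this.trans hδ
  | succ k ih =>
    intro a ha hs
    -- `Nat.pair` cuts the indices into infinitely many infinite blocks. Either one block works, or
    -- each block `p` has an index `q p` whose row has mass above `δ` on `s p`, inside the block.
    -- These sets miss the transversal `p ↦ Nat.pair p (q p)`, so restricting to it lowers the row
    -- sums by `δ`.
    by_cases h : ∃ p : ℕ, ∀ (q : ℕ) (s : Finset ℕ), q ∉ s →
        ∑ m ∈ s, a (Nat.pair p q) (Nat.pair p m) ≤ δ
    · obtain ⟨p, hp⟩ := h
      exact ⟨Nat.pair p, fun x y hxy => (Nat.pair_eq_pair.1 hxy).2, hp⟩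
    · push Not at h
      choose q s hqs hlt using h
      have hinj : Function.Injective fun p => Nat.pair p (q p) :=
        fun x y hxy => (Nat.pair_eq_pair.1 hxy).1
      obtain ⟨σ, hσ, H⟩ := ih (fun p p' => a (Nat.pair p (q p)) (Nat.pair p' (q p')))
        (fun _ _ => ha _ _) (fun p t => by
          have hdisj : Disjoint (t.image fun p' => Nat.pair p' (q p'))
              ((s p).image fun m => Nat.pair p m) := by
            rw [Finset.disjoint_left]
            intro x hx hx'
            obtain ⟨p', -, rfl⟩ := Finset.mem_image.1 hx
            obtain ⟨m, hm, he⟩ := Finset.mem_image.1 hx'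
            obtain ⟨rfl, rfl⟩ := Nat.pair_eq_pair.1 he
            exact hqs _ hm
          have h1 := hs (Nat.pair p (q p)) ((t.image fun p' => Nat.pair p' (q p')) ∪
            ((s p).image fun m => Nat.pair p m))
          rw [Finset.sum_union hdisj, Finset.sum_image hinj.injOn,
            Finset.sum_image (fun x _ y _ hxy => (Nat.pair_eq_pair.1 hxy).2)] at h1
          have h2 := hlt p
          push_cast at h1
          linarith)
      exact ⟨fun n => Nat.pair (σ n) (q (σ n)), hinj.comp hσ, H⟩

/-- Rosenthal's disjointness lemma. -/
theorem rosenthal {C δ : ℝ} (hδ : 0 < δ) (a : ℕ → ℕ → ℝ) (ha : ∀ n m, 0 ≤ a n m)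
    (hs : ∀ n (s : Finset ℕ), ∑ m ∈ s, a n m ≤ C) :
    ∃ σ : ℕ → ℕ, Function.Injective σ ∧
      ∀ n (s : Finset ℕ), n ∉ s → ∑ m ∈ s, a (σ n) (σ m) ≤ δ := by
  obtain ⟨k, hk⟩ := exists_nat_ge (C / δ)
  exact rosenthal_of_le_nsmul hδ.le k a ha
    fun n s => (hs n s).trans ((div_le_iff₀ hδ).1 hk)

/-- If the diagonal of a matrix with bounded absolute row sums does not tend to zero, then some
submatrix has a large diagonal and small row sums off the diagonal. -/
theorem exists_submatrix_of_not_tendsto {C : ℝ} (a : ℕ → ℕ → ℝ)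
    (hs : ∀ n (s : Finset ℕ), ∑ m ∈ s, |a n m| ≤ C)
    (h : ¬ Tendsto (fun n => a n n) atTop (𝓝 0)) :
    ∃ δ : ℝ, 0 < δ ∧ ∃ σ : ℕ → ℕ, Function.Injective σ ∧ (∀ n, 4 * δ ≤ |a (σ n) (σ n)|) ∧
      ∀ n (s : Finset ℕ), n ∉ s → ∑ m ∈ s, |a (σ n) (σ m)| ≤ δ := by
  rw [Metric.tendsto_atTop] at h
  push Not at h
  obtain ⟨ε, hε, hN⟩ := h
  obtain ⟨τ, hτ, hτa⟩ := extraction_of_frequently_atTop (frequently_atTop.2 hN)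
  obtain ⟨σ, hσ, H⟩ := rosenthal (C := C) (δ := ε / 4) (by positivity)
    (fun n m => |a (τ n) (τ m)|) (fun _ _ => abs_nonneg _) (fun n s => by
      have := hs (τ n) (s.image τ)
      rwa [Finset.sum_image hτ.injective.injOn] at this)
  refine ⟨ε / 4, by positivity, τ ∘ σ, hτ.injective.comp hσ, fun n => ?_, H⟩
  have := hτa (σ n)
  rw [Real.dist_eq, sub_zero] at this
  simp only [Function.comp]
  linarith

/-! ### Weakly compact operators and wuC series. -/

section Operators

variable {E F : Type*} [NormedAddCommGroup E] [NormedSpace ℝ E]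
  [NormedAddCommGroup F] [NormedSpace ℝ F]

/-- The image of a bounded sequence under a weakly compact operator has a weak cluster point. -/
theorem IsWeaklyCompactOperator.exists_weak_cluster {S : E →L[ℝ] F}
    (hS : IsWeaklyCompactOperator S) {ψ : ℕ → E} {M : ℝ} (hψ : ∀ n, ‖ψ n‖ ≤ M) :
    ∃ z : F,
      (∀ (θ : StrongDual ℝ F) (A : Set ℝ), IsClosed A → (∀ᶠ n in atTop, θ (S (ψ n)) ∈ A) →
        θ z ∈ A) ∧
      ∀ D : Set F, Convex ℝ D → (∀ n, S (ψ n) ∈ D) → z ∈ closure D := by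
  have hM : 0 < M + 1 := by linarith [(norm_nonneg _).trans (hψ 0)]
  set r : ℝ := M + 1
  have hmem : ∀ n, toWeakSpace ℝ F (S (r⁻¹ • ψ n)) ∈
      closure (toWeakSpace ℝ F '' (S '' Metric.closedBall (0 : E) 1)) := fun n => by
    refine subset_closure ⟨_, ⟨_, ?_, rfl⟩, rfl⟩
    rw [mem_closedBall_zero_iff, norm_smul, norm_inv, Real.norm_of_nonneg hM.le,
      inv_mul_le_one₀ hM]
    exact (hψ n).trans (by simp [r])
  obtain ⟨z, -, hz⟩ := IsCompact.exists_mapClusterPt (f := atTop) hS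
    (u := fun n => toWeakSpace ℝ F (S (r⁻¹ • ψ n)))
    (tendsto_principal.2 (Eventually.of_forall hmem))
  have hz' : MapClusterPt (r • z) atTop (fun n => toWeakSpace ℝ F (S (ψ n))) := by
    have := hz.continuousAt_comp (f := fun v : WeakSpace ℝ F => r • v)
      (continuous_const_smul r).continuousAt
    convert this using 2 with n
    simp only [Function.comp]
    rw [← map_smul, ← map_smul, smul_inv_smul₀ hM.ne']
  have key : ∀ A : Set (WeakSpace ℝ F), IsClosed A →
      (∀ᶠ n in atTop, toWeakSpace ℝ F (S (ψ n)) ∈ A) → r • z ∈ A := fun A hA h => by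
    rw [← hA.closure_eq, mem_closure_iff_clusterPt]
    exact ClusterPt.mono hz' (by simpa using h)
  refine ⟨(toWeakSpace ℝ F).symm (r • z), fun θ A hA h => ?_, fun D hD h => ?_⟩
  · exact key _ (hA.preimage (WeakBilin.eval_continuous (topDualPairing ℝ F).flip θ)) h
  -- Mazur: the weak and norm closures of a convex set coincide.
  · have := key _ isClosed_closure
      (Eventually.of_forall fun n => subset_closure (Set.mem_image_of_mem _ (h n)))
    rw [← hD.toWeakSpace_closure ℝ] at this
    obtain ⟨y, hy, he⟩ := this
    rw [← he, LinearEquiv.symm_apply_apply]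
    exact hy

/-- A weakly unconditionally Cauchy series of functionals tends to zero along the image of a
bounded sequence under a weakly compact operator. -/
theorem IsWeaklyCompactOperator.tendsto_of_functionals {S : E →L[ℝ] F}
    (hS : IsWeaklyCompactOperator S) {ψ : ℕ → E} {M : ℝ} (hψ : ∀ n, ‖ψ n‖ ≤ M)
    {θ : ℕ → StrongDual ℝ F} {C : ℝ}
    (hθ : ∀ (y : F) (s : Finset ℕ), ∑ n ∈ s, |θ n y| ≤ C * ‖y‖) :
    Tendsto (fun n => θ n (S (ψ n))) atTop (𝓝 0) := by
  have hC : ∀ y : F, 0 ≤ C * ‖y‖ := fun y => by simpa using hθ y ∅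
  by_contra hcon
  obtain ⟨δ, hδ, σ, hσ, hdiag, hoff⟩ := exists_submatrix_of_not_tendsto
    (C := |C| * (‖S‖ * M)) (fun n m => θ m (S (ψ n))) (fun n s => by
      refine (hθ _ s).trans ?_
      gcongr
      · exact le_abs_self C
      · exact (S.le_opNorm _).trans (by gcongr; exact hψ n)) hcon
  have hθσ : ∀ (y : F) (s : Finset ℕ), ∑ n ∈ s, |θ (σ n) y| ≤ C * ‖y‖ := fun y s => by
    have := hθ y (s.image σ)
    rwa [Finset.sum_image hσ.injOn] at this
  have hsum : ∀ y, Summable fun n => |θ (σ n) y| := fun y =>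
    summable_of_sum_le (fun _ => abs_nonneg _) (hθσ y)
  have hsumN : ∀ N y, Summable fun n => |θ (σ (n + N)) y| := fun N y =>
    (summable_nat_add_iff N).2 (hsum y)
  have htsum : ∀ N y, |∑' n, θ (σ (n + N)) y| ≤ ∑' n, |θ (σ (n + N)) y| := fun N y =>
    norm_tsum_le_tsum_norm (f := fun n => θ (σ (n + N)) y) (hsumN N y)
  -- `L N` is the tail sum of the functionals from `N` on. It is at least `4δ - δ` in absolute value
  -- on every later vector of the sequence, hence also at the weak cluster point `z`, where the tail
  -- is below `δ` for large `N`.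
  obtain ⟨L, hL⟩ : ∃ L : ℕ → StrongDual ℝ F, ∀ N y, L N y = ∑' n, θ (σ (n + N)) y := by
    refine ⟨fun N => LinearMap.mkContinuous
      { toFun := fun y => ∑' n, θ (σ (n + N)) y
        map_add' := fun x y => ?_
        map_smul' := fun c x => ?_ } C fun y => ?_, fun _ _ => rfl⟩
    · simp only [map_add]
      exact (hsumN N x).of_abs.tsum_add (hsumN N y).of_abs
    · simp only [map_smul, smul_eq_mul, tsum_mul_left, RingHom.id_apply]
    · refine (htsum N y).trans ?_
      refine Real.tsum_le_of_sum_le (fun _ => abs_nonneg _) fun s => ?_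
      have := hθσ y (s.map (addRightEmbedding N))
      rwa [Finset.sum_map] at this
  obtain ⟨z, hz, -⟩ := hS.exists_weak_cluster (ψ := ψ ∘ σ) (fun n => hψ _)
  have htail := tendsto_sum_nat_add fun n => |θ (σ n) z|
  obtain ⟨N, hN⟩ := (htail.eventually (gt_mem_nhds hδ)).exists
  have hLz : |L N z| < δ := by
    rw [hL]
    exact (htsum N z).trans_lt hN
  have hmem : L N z ∈ {t : ℝ | 3 * δ ≤ |t|} := by
    refine hz (L N) _ (isClosed_le continuous_const continuous_abs) ?_
    filter_upwards [eventually_ge_atTop N] with n hn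
    obtain ⟨k, rfl⟩ := Nat.exists_eq_add_of_le' hn
    set v := S ((ψ ∘ σ) (k + N))
    have h1 : L N v = θ (σ (k + N)) v + ∑' m, if m = k then 0 else θ (σ (m + N)) v :=
      (hL N v).trans ((hsumN N v).of_abs.tsum_eq_add_tsum_ite k)
    have h2 : |∑' m, if m = k then 0 else θ (σ (m + N)) v| ≤ δ := by
      have hs : Summable fun m => ‖if m = k then 0 else θ (σ (m + N)) v‖ := by
        refine (hsumN N v).of_nonneg_of_le (fun _ => norm_nonneg _) fun m => ?_
        split_ifs <;> simp
      refine (norm_tsum_le_tsum_norm hs).trans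
        (Real.tsum_le_of_sum_le (fun _ => norm_nonneg _) fun s => ?_)
      have h3 := hoff (k + N) ((s.erase k).map (addRightEmbedding N)) (by simp)
      refine le_trans (le_of_eq ?_) h3
      rw [Finset.sum_map, ← Finset.sum_filter_add_sum_filter_not s (fun m => m = k)]
      rw [Finset.sum_eq_zero (s := s.filter (fun m => m = k)), zero_add, ← Finset.filter_ne']
      · refine Finset.sum_congr rfl fun m hm => ?_
        rw [if_neg (Finset.mem_filter.1 hm).2]
        rfl
      · intro m hm
        simp [(Finset.mem_filter.1 hm).2]
    have h4 := hdiag (k + N)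
    have h5 := abs_sub_abs_le_abs_sub (θ (σ (k + N)) v)
      (-∑' m, if m = k then 0 else θ (σ (m + N)) v)
    rw [sub_neg_eq_add, abs_neg, ← h1] at h5
    change 3 * δ ≤ |L N v|
    change 4 * δ ≤ |θ (σ (k + N)) v| at h4
    linarith
  have : 3 * δ ≤ |L N z| := hmem
  linarith

/-- A weakly compact operator maps a weakly unconditionally Cauchy series to a norm-null
sequence. -/
theorem IsWeaklyCompactOperator.tendsto_of_series {S : E →L[ℝ] F}
    (hS : IsWeaklyCompactOperator S) {e : ℕ → E} {C : ℝ}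
    (he : ∀ (φ : StrongDual ℝ E) (s : Finset ℕ), ∑ n ∈ s, |φ (e n)| ≤ C * ‖φ‖)
    {θ : ℕ → StrongDual ℝ F} {M : ℝ} (hθ : ∀ n, ‖θ n‖ ≤ M) :
    Tendsto (fun n => θ n (S (e n))) atTop (𝓝 0) := by
  have hM : 0 ≤ M := (norm_nonneg _).trans (hθ 0)
  have he' : ∀ (φ : StrongDual ℝ E) (s : Finset ℕ), ∑ n ∈ s, |φ (e n)| ≤ |C| * ‖φ‖ :=
    fun φ s => (he φ s).trans (by gcongr; exact le_abs_self C)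
  by_contra hcon
  obtain ⟨δ, hδ, σ, hσ, hdiag, hoff⟩ := exists_submatrix_of_not_tendsto
    (C := |C| * (M * ‖S‖)) (fun n m => θ n (S (e m))) (fun n s => by
      refine (he' ((θ n).comp S) s).trans ?_
      gcongr
      exact ((θ n).opNorm_comp_le S).trans (by gcongr; exact hθ n)) hcon
  have hpart : ∀ N, ‖∑ m ∈ Finset.range N, e (σ m)‖ ≤ |C| := fun N => by
    refine NormedSpace.norm_le_dual_bound ℝ _ (abs_nonneg C) fun φ => ?_
    rw [map_sum]
    refine (norm_sum_le _ _).trans ?_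
    have := he' φ ((Finset.range N).image σ)
    rwa [Finset.sum_image hσ.injOn] at this
  obtain ⟨z, hz, hzD⟩ := hS.exists_weak_cluster hpart
  have hbig : ∀ n, 3 * δ ≤ |θ (σ n) z| := fun n => by
    refine hz (θ (σ n)) {t | 3 * δ ≤ |t|} (isClosed_le continuous_const continuous_abs) ?_
    filter_upwards [eventually_gt_atTop n] with N hN
    have hn : n ∈ Finset.range N := Finset.mem_range.2 hN
    change 3 * δ ≤ |θ (σ n) (S (∑ m ∈ Finset.range N, e (σ m)))|
    rw [map_sum, map_sum, ← Finset.add_sum_erase _ _ hn]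
    have h1 := hoff n ((Finset.range N).erase n) (by simp)
    have h2 := (Finset.abs_sum_le_sum_abs
      (fun m => θ (σ n) (S (e (σ m)))) ((Finset.range N).erase n)).trans h1
    have h3 := hdiag n
    have h4 := abs_sub_abs_le_abs_sub (θ (σ n) (S (e (σ n))))
      (-∑ m ∈ (Finset.range N).erase n, θ (σ n) (S (e (σ m))))
    rw [sub_neg_eq_add, abs_neg] at h4
    linarith
  -- Every partial sum has small values under the late functionals. This condition is convex, so by
  -- Mazur `z` is a norm limit of such vectors, forcing `|θ (σ n) z| ≤ 2δ` for some `n`, against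
  -- `hbig`.
  have hcl := hzD {v | ∀ᶠ n in atTop, |θ (σ n) v| ≤ δ} (by
    intro x hx y hy a b ha hb hab
    filter_upwards [hx, hy] with n h1 h2
    rw [map_add, map_smul, map_smul, smul_eq_mul, smul_eq_mul]
    calc |a * θ (σ n) x + b * θ (σ n) y| ≤ a * |θ (σ n) x| + b * |θ (σ n) y| := by
          refine (abs_add_le _ _).trans ?_
          rw [abs_mul, abs_mul, abs_of_nonneg ha, abs_of_nonneg hb]
      _ ≤ a * δ + b * δ := by gcongr
      _ = δ := by rw [← add_mul, hab, one_mul]) (fun N => by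
    filter_upwards [eventually_ge_atTop N] with n hn
    rw [map_sum, map_sum]
    exact (Finset.abs_sum_le_sum_abs _ _).trans (hoff n _ (by simpa using hn)))
  obtain ⟨v, hv, hdist⟩ := Metric.mem_closure_iff.1 hcl (δ / (M + 1)) (by positivity)
  obtain ⟨n, hn⟩ := Eventually.exists hv
  have h1 : |θ (σ n) (z - v)| ≤ δ := by
    refine ((θ (σ n)).le_opNorm _).trans ?_
    rw [dist_eq_norm] at hdist
    calc ‖θ (σ n)‖ * ‖z - v‖ ≤ (M + 1) * (δ / (M + 1)) := by
          gcongr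
          linarith [hθ (σ n)]
      _ = δ := by field_simp
  rw [map_sub] at h1
  have h2 := abs_sub_abs_le_abs_sub (θ (σ n) z) (θ (σ n) v)
  linarith [hbig n]

end Operators

/-- If `R* = G + S` with `S` weakly compact and the functionals `δ n` are eigenvectors of `G`, then
`δ n ∘ R²` is a nonnegative multiple of `δ n` up to a null sequence, along a weakly unconditionally
Cauchy series. -/
theorem exists_sq_apply_eq_of_banachAdjoint_eq {E : Type*} [NormedAddCommGroup E]
    [NormedSpace ℝ E] {R : E →L[ℝ] E} {G S : StrongDual ℝ E →L[ℝ] StrongDual ℝ E}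
    (hS : IsWeaklyCompactOperator S) (hR : banachAdjoint R = G + S) {w : ℕ → E} {M : ℝ}
    (hw : ∀ (φ : StrongDual ℝ E) (s : Finset ℕ), ∑ n ∈ s, |φ (w n)| ≤ M * ‖φ‖) (hM : 0 ≤ M)
    {δ : ℕ → StrongDual ℝ E} (hδ : ∀ n, ‖δ n‖ ≤ 1) {g : ℕ → ℝ} (hG : ∀ n, G (δ n) = g n • δ n) :
    ∃ q : ℕ → ℝ, Tendsto q atTop (𝓝 0) ∧
      ∀ n, δ n (R (R (w n))) = g n ^ 2 * δ n (w n) + q n := by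
  have hdual : ∀ (φ : StrongDual ℝ E) f, φ (R f) = G φ f + S φ f := fun φ f => by
    change banachAdjoint R φ f = _
    rw [hR]
    rfl
  -- `θ n` and `η n` represent `w n` and `R (w n)` in the bidual. They evaluate the two error terms
  -- of `R*R* δ = GGδ + SGδ + R*Sδ`.
  let θ : ℕ → StrongDual ℝ (StrongDual ℝ E) := fun n => NormedSpace.inclusionInDoubleDual ℝ E (w n)
  let η : ℕ → StrongDual ℝ (StrongDual ℝ E) := fun n => (θ n).comp (banachAdjoint R)
  have h1 : Tendsto (fun n => θ n (S (G (δ n)))) atTop (𝓝 0) :=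
    hS.tendsto_of_functionals (M := ‖G‖)
      (fun n => (G.le_opNorm _).trans (mul_le_of_le_one_right (norm_nonneg _) (hδ n))) hw
  have h2 : Tendsto (fun n => η n (S (δ n))) atTop (𝓝 0) :=
    hS.tendsto_of_functionals hδ (C := M * ‖banachAdjoint R‖) fun y s =>
      (hw (banachAdjoint R y) s).trans (by
        rw [mul_assoc]
        gcongr
        exact (banachAdjoint R).le_opNorm y)
  refine ⟨_, by simpa using h1.add h2, fun n => ?_⟩
  change _ = _ + (S (G (δ n)) (w n) + S (δ n) (R (w n)))
  rw [hdual (δ n), hdual (G (δ n)), hG, map_smul, hG, smul_smul, pow_two,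
    smul_apply, smul_eq_mul]
  ring

/-! ### Disjoint sequences, extension by zero and the norm criterion in `C(X)`. -/

section CompactSpaces

variable {X : Type*} [TopologicalSpace X] [CompactSpace X]

theorem norm_evalCLM_le_one (x : X) :
    ‖(ContinuousMap.evalCLM ℝ x : StrongDual ℝ C(X, ℝ))‖ ≤ 1 :=
  ContinuousLinearMap.opNorm_le_bound _ zero_le_one fun f => by
    rw [one_mul]
    exact f.norm_coe_le_norm x

/-- A bounded disjoint sequence of continuous functions is a weakly unconditionally Cauchy
series. -/
theorem sum_abs_apply_le_of_disjoint {w : ℕ → C(X, ℝ)} {M : ℝ} (hM : 0 ≤ M)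
    (hw : ∀ n x, |w n x| ≤ M) (hd : ∀ n m x, n ≠ m → w n x = 0 ∨ w m x = 0)
    (φ : StrongDual ℝ C(X, ℝ)) (s : Finset ℕ) : ∑ n ∈ s, |φ (w n)| ≤ M * ‖φ‖ := by
  -- By disjointness at most one term is nonzero at each point, and `φ` turns this signed sum into
  -- the sum of absolute values.
  have hnorm : ‖∑ n ∈ s, (SignType.sign (φ (w n)) : ℝ) • w n‖ ≤ M := by
    rw [ContinuousMap.norm_le _ hM]
    intro x
    rw [ContinuousMap.sum_apply]
    by_cases h : ∃ n ∈ s, w n x ≠ 0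
    · obtain ⟨n, hn, hnx⟩ := h
      rw [Finset.sum_eq_single_of_mem n hn fun m _ hmn => by
        simp [(hd m n x hmn).resolve_right hnx]]
      rw [ContinuousMap.smul_apply, norm_smul]
      refine (mul_le_of_le_one_left (norm_nonneg _) ?_).trans (hw n x)
      rcases SignType.trichotomy (SignType.sign (φ (w n))) with h | h | h <;> simp [h]
    · push Not at h
      rw [Finset.sum_eq_zero fun n hn => by simp [h n hn], norm_zero]
      exact hM
  calc ∑ n ∈ s, |φ (w n)| = φ (∑ n ∈ s, (SignType.sign (φ (w n)) : ℝ) • w n) := by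
        simp [map_sum, sign_mul_self]
    _ ≤ ‖φ‖ * ‖∑ n ∈ s, (SignType.sign (φ (w n)) : ℝ) • w n‖ :=
        (le_abs_self _).trans (φ.le_opNorm _)
    _ ≤ M * ‖φ‖ := by rw [mul_comm M]; gcongr

/-- Evaluation at `x` is the Dirac measure, which multiplication by `g` merely rescales. The
argument needs `G` only on these functionals. -/
theorem IsMultiplicationBy.apply_evalCLM [T1Space X] [MeasurableSpace X] [BorelSpace X]
    {g : X → ℝ} {G : StrongDual ℝ C(X, ℝ) →L[ℝ] StrongDual ℝ C(X, ℝ)}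
    (hG : IsMultiplicationBy g G) (x : X) :
    G (ContinuousMap.evalCLM ℝ x) = g x • ContinuousMap.evalCLM ℝ x := by
  have hreg : (Measure.dirac x).Regular :=
    { lt_top_of_isCompact := fun K _ => measure_lt_top _ K
      outerRegular := fun A hA r hr => by
        rw [Measure.dirac_apply] at hr
        by_cases hx : x ∈ A
        · refine ⟨Set.univ, Set.subset_univ _, isOpen_univ, ?_⟩
          simpa [hx] using hr
        · refine ⟨{x}ᶜ, fun y hy h => hx (h ▸ hy), isOpen_compl_singleton, ?_⟩
          simpa [hx] using hr
      innerRegular := fun U hU r hr => by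
        rw [Measure.dirac_apply] at hr
        by_cases hx : x ∈ U
        · refine ⟨{x}, by simpa using hx, isCompact_singleton, ?_⟩
          simpa [hx] using hr
        · simp [hx] at hr }
  ext f
  have := hG (ContinuousMap.evalCLM ℝ x) (Measure.dirac x) 0 inferInstance hreg
    inferInstance inferInstance (fun f => by simp) f
  rw [this]
  simp [mul_comm]

/-- The diagonal values of the square of a weak multiplier along a bounded disjoint sequence are
nonnegative multiples of the values of the sequence, up to a null sequence. -/
theorem IsWeakMultiplier.sq_apply [T1Space X] [MeasurableSpace X] [BorelSpace X]
    {R : C(X, ℝ) →L[ℝ] C(X, ℝ)} (hR : IsWeakMultiplier R) {w : ℕ → C(X, ℝ)} {M : ℝ}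
    (hM : 0 ≤ M) (hw : ∀ n x, |w n x| ≤ M) (hd : ∀ n m x, n ≠ m → w n x = 0 ∨ w m x = 0)
    (x : ℕ → X) :
    ∃ q : ℕ → ℝ, Tendsto q atTop (𝓝 0) ∧
      ∀ n, ∃ c : ℝ, 0 ≤ c ∧ R (R (w n)) (x n) = c * w n (x n) + q n := by
  obtain ⟨g, -, G, S, hG, hS, hRGS⟩ := hR
  obtain ⟨q, hq, h⟩ := exists_sq_apply_eq_of_banachAdjoint_eq hS hRGS
    (sum_abs_apply_le_of_disjoint hM hw hd) hM (fun n => norm_evalCLM_le_one (x n))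
    (fun n => hG.apply_evalCLM (x n))
  exact ⟨q, hq, fun n => ⟨g (x n) ^ 2, sq_nonneg _, h n⟩⟩

/-- The diagonal values of a composition with a weakly compact factor along a bounded disjoint
sequence tend to zero. -/
theorem tendsto_comp_apply_of_isWeaklyCompactOperator {F : Type*} [NormedAddCommGroup F]
    [NormedSpace ℝ F] (A : C(X, ℝ) →L[ℝ] F) (B : F →L[ℝ] C(X, ℝ))
    (h : IsWeaklyCompactOperator A ∨ IsWeaklyCompactOperator B) {w : ℕ → C(X, ℝ)} {M : ℝ}
    (hM : 0 ≤ M) (hw : ∀ n x, |w n x| ≤ M) (hd : ∀ n m x, n ≠ m → w n x = 0 ∨ w m x = 0)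
    (x : ℕ → X) : Tendsto (fun n => B (A (w n)) (x n)) atTop (𝓝 0) := by
  have hwuc := sum_abs_apply_le_of_disjoint hM hw hd
  -- If `A` is weakly compact, the functionals `δ_{x n} ∘ B` are bounded. If `B` is, the series `A
  -- (w n)` is still wuC.
  rcases h with h | h
  · exact h.tendsto_of_series hwuc (M := ‖B‖)
      (θ := fun n => (ContinuousMap.evalCLM ℝ (x n) : StrongDual ℝ C(X, ℝ)).comp B)
      fun n => (ContinuousLinearMap.opNorm_comp_le _ _).trans
        (mul_le_of_le_one_left (norm_nonneg _) (norm_evalCLM_le_one _))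
  · exact h.tendsto_of_series (e := fun n => A (w n)) (C := M * ‖A‖) (M := 1)
      (θ := fun n => (ContinuousMap.evalCLM ℝ (x n) : StrongDual ℝ C(X, ℝ)))
      (fun φ s => (hwuc (φ.comp A) s).trans (by
        rw [mul_assoc, mul_comm ‖A‖]
        gcongr
        exact φ.opNorm_comp_le A))
      fun n => norm_evalCLM_le_one _

/-- A nonempty open subset of a perfect compact Hausdorff space carries a disjoint sequence of
bump functions. -/
theorem exists_disjoint_bumps [T2Space X] [PerfectSpace X] {U : Set X} (hU : IsOpen U)
    (hne : U.Nonempty) :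
    ∃ (x : ℕ → X) (u : ℕ → C(X, ℝ)), (∀ n, x n ∈ U) ∧ (∀ n, u n (x n) = 1) ∧
      (∀ n y, u n y ∈ Set.Icc (0 : ℝ) 1) ∧ ∀ n m y, n ≠ m → u n y = 0 ∨ u m y = 0 := by
  obtain ⟨a, ha⟩ := hne
  have : Infinite U := (infinite_of_mem_nhds a (hU.mem_nhds ha)).to_subtype
  obtain ⟨V, hVi, hVo, hVd⟩ := exists_seq_infinite_isOpen_pairwise_disjoint U
  choose x hx using fun n => (hVi n).nonempty
  have hVo' : ∀ n, IsOpen (((↑) : U → X) '' V n) := fun n =>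
    hU.isOpenEmbedding_subtypeVal.isOpenMap _ (hVo n)
  choose u hu0 hu1 hu using fun n => exists_continuous_zero_one_of_isClosed
    (hVo' n).isClosed_compl (isClosed_singleton (x := (x n : X)))
    (Set.disjoint_singleton_right.2 fun h => h ⟨x n, hx n, rfl⟩)
  refine ⟨fun n => x n, u, fun n => (x n).2, fun n => hu1 n rfl, hu, fun n m y hnm => ?_⟩
  by_contra! h
  have h1 : y ∈ ((↑) : U → X) '' V n := by
    by_contra hy
    exact h.1 (hu0 n hy)
  have h2 : y ∈ ((↑) : U → X) '' V m := by
    by_contra hy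
    exact h.2 (hu0 m hy)
  obtain ⟨y1, hy1, rfl⟩ := h1
  obtain ⟨y2, hy2, he⟩ := h2
  rw [Subtype.coe_injective he] at hy2
  exact Set.disjoint_left.1 (hVd hnm) hy1 hy2

/-- Extension by zero of continuous functions along an open and closed embedding. -/
theorem exists_extendByZero {K : Type*} [TopologicalSpace K] [CompactSpace K] {j : X → K}
    (hj : IsOpenEmbedding j) (hcl : IsClosed (Set.range j)) :
    ∃ e : C(X, ℝ) →L[ℝ] C(K, ℝ), (∀ f x, e f (j x) = f x) ∧
      ∀ f, ∀ y ∉ Set.range j, e f y = 0 := by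
  have hcont : ∀ f : C(X, ℝ), Continuous (Function.extend j f 0) := fun f => by
    rw [continuous_iff_continuousAt]
    intro y
    by_cases hy : y ∈ Set.range j
    · obtain ⟨x, rfl⟩ := hy
      rw [← hj.continuousAt_iff, show Function.extend j f 0 ∘ j = f from funext fun x =>
        hj.injective.extend_apply _ _ _]
      exact f.continuous.continuousAt
    · refine (continuousAt_const (y := (0 : ℝ))).congr ?_
      filter_upwards [hcl.isOpen_compl.mem_nhds hy] with z hz
      rw [Function.extend_apply' _ _ _ (by simpa using hz)]
      rfl
  have h1 : ∀ (f : C(X, ℝ)) x, Function.extend j f 0 (j x) = f x :=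
    fun f x => hj.injective.extend_apply _ _ _
  have h2 : ∀ (f : C(X, ℝ)), ∀ y ∉ Set.range j, Function.extend j f 0 y = 0 := fun f y hy => by
    rw [Function.extend_apply' _ _ _ (by simpa using hy)]
    rfl
  refine ⟨LinearMap.mkContinuous
    { toFun := fun f => ⟨Function.extend j f 0, hcont f⟩
      map_add' := fun f g => ?_
      map_smul' := fun c f => ?_ } 1 fun f => ?_, h1, h2⟩
  · ext y
    by_cases hy : y ∈ Set.range j
    · obtain ⟨x, rfl⟩ := hy
      simp only [ContinuousMap.coe_mk, ContinuousMap.add_apply, h1]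
    · simp only [ContinuousMap.coe_mk, ContinuousMap.add_apply, h2 _ y hy, add_zero]
  · ext y
    by_cases hy : y ∈ Set.range j
    · obtain ⟨x, rfl⟩ := hy
      simp only [ContinuousMap.coe_mk, ContinuousMap.smul_apply, h1, RingHom.id_apply]
    · simp only [ContinuousMap.coe_mk, ContinuousMap.smul_apply, h2 _ y hy, smul_zero]
  · rw [one_mul, ContinuousMap.norm_le _ (norm_nonneg f)]
    intro y
    change ‖Function.extend j f 0 y‖ ≤ _
    by_cases hy : y ∈ Set.range j
    · obtain ⟨x, rfl⟩ := hy
      rw [h1]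
      exact f.norm_coe_le_norm x
    · rw [h2 _ y hy, norm_zero]
      exact norm_nonneg f

/-- If `‖A‖` is attained up to `ε` at functions whose values near the point can be raised to `1`
at small cost, then `‖Id + A‖ = 1 + ‖A‖`. -/
theorem norm_id_add_eq_of_forall_exists {A : C(X, ℝ) →L[ℝ] C(X, ℝ)} [Nonempty X]
    (h : ∀ (f : C(X, ℝ)) (U : Set X) (ε : ℝ), ‖f‖ ≤ 1 → IsOpen U → U.Nonempty → 0 < ε →
      ∃ x ∈ U, ∃ v : C(X, ℝ), ‖f + v‖ ≤ 1 ∧ f x + v x = 1 ∧ -ε ≤ A v x) :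
    ‖ContinuousLinearMap.id ℝ C(X, ℝ) + A‖ = 1 + ‖A‖ := by
  refine le_antisymm ((ContinuousLinearMap.opNorm_add_le _ _).trans ?_) ?_
  · gcongr
    exact ContinuousLinearMap.norm_id_le
  · refine le_of_forall_pos_le_add fun ε hε => ?_
    obtain ⟨f, hf, x, hx⟩ : ∃ f : C(X, ℝ), ‖f‖ ≤ 1 ∧ ∃ x, ‖A‖ - ε / 2 < A f x := by
      obtain ⟨f, hf, hAf⟩ : ∃ f : C(X, ℝ), ‖f‖ ≤ 1 ∧ ‖A‖ - ε / 2 < ‖A f‖ := by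
        obtain ⟨f, hf, hAf⟩ := A.exists_lt_apply_of_lt_opNorm (sub_lt_self ‖A‖ (half_pos hε))
        exact ⟨f, hf.le, hAf⟩
      by_contra! hcon
      refine hAf.not_ge ((ContinuousMap.norm_le_of_nonempty _).2 fun x => abs_le.2 ⟨?_, ?_⟩)
      · have := hcon (-f) (by simpa using hf) x
        rw [map_neg, ContinuousMap.neg_apply] at this
        linarith
      · exact hcon f hf x
    -- At `y`, `(Id + A)(f + v)` is at least `1 + (‖A‖ - ε / 2) - ε / 2`.
    obtain ⟨y, hy, v, hv, hv1, hAv⟩ := h f {y | ‖A‖ - ε / 2 < A f y} (ε / 2) hf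
      (isOpen_lt continuous_const (A f).continuous) ⟨x, hx⟩ (by positivity)
    have h1 := (ContinuousLinearMap.id ℝ C(X, ℝ) + A).le_of_opNorm_le_of_le le_rfl hv
    have h2 := (le_abs_self _).trans
      (((ContinuousLinearMap.id ℝ C(X, ℝ) + A) (f + v)).norm_coe_le_norm y)
    have h3 : (ContinuousLinearMap.id ℝ C(X, ℝ) + A) (f + v) y
        = (f y + v y) + (A f y + A v y) := by
      rw [add_apply, map_add A]
      rfl
    have hy' : ‖A‖ - ε / 2 < A f y := hy
    rw [h3, hv1] at h2
    linarith

end CompactSpaces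

/-! ### The block decomposition of `T²`. -/

theorem mainTheorem7 (X : ℕ → Type*) [∀ i, TopologicalSpace (X i)] [∀ i, CompactSpace (X i)]
    [∀ i, T2Space (X i)] [∀ i, PerfectSpace (X i)]
    [∀ i, MeasurableSpace (X i)] [∀ i, BorelSpace (X i)]
    (hX : ∀ (i : ℕ) (T : C(X i, ℝ) →L[ℝ] C(X i, ℝ)), IsWeakMultiplier T)
    (K : Type*) [TopologicalSpace K] [CompactSpace K] [T2Space K] [Nonempty K]
    (c : CompactificationOfUnion X K)
    (hc : ∀ i : ℕ,
      (∀ T : C(X i, ℝ) →L[ℝ] C(c.coPiece i, ℝ), IsWeaklyCompactOperator T) ∨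
      (∀ T : C(c.coPiece i, ℝ) →L[ℝ] C(X i, ℝ), IsWeaklyCompactOperator T)) :
    IsExtremelyNonComplex C(K, ℝ) := by
  intro T
  refine norm_id_add_eq_of_forall_exists fun f U ε hf hU hne hε => ?_
  obtain ⟨⟨i, a⟩, ha⟩ := c.denseRange.exists_mem_open hU hne
  have hj : IsOpenEmbedding fun x : X i => c.emb ⟨i, x⟩ :=
    c.isOpenEmbedding.comp IsOpenEmbedding.sigmaMk
  let j : C(X i, K) := ⟨fun x => c.emb ⟨i, x⟩, hj.continuous⟩
  have hcl : IsClosed (Set.range j) := (isCompact_range j.continuous).isClosed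
  let j' : C(c.coPiece i, K) := ⟨Subtype.val, continuous_subtype_val⟩
  have hj' : IsOpenEmbedding j' := (c.coPiece i).isClopen.isOpen.isOpenEmbedding_subtypeVal
  have hrange' : Set.range j' = (Set.range j)ᶜ := Subtype.range_coe
  have hcl' : IsClosed (Set.range j') := by
    rw [hrange']
    exact hj.isOpen_range.isClosed_compl
  obtain ⟨e, he, he0⟩ := exists_extendByZero hj hcl
  obtain ⟨e', he', he0'⟩ := exists_extendByZero hj' hcl'
  let r : C(K, ℝ) →L[ℝ] C(X i, ℝ) :=
    ⟨(ContinuousMap.compRightAlgHom ℝ ℝ j).toLinearMap, ContinuousMap.continuous_precomp j⟩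
  let r' : C(K, ℝ) →L[ℝ] C(c.coPiece i, ℝ) :=
    ⟨(ContinuousMap.compRightAlgHom ℝ ℝ j').toLinearMap, ContinuousMap.continuous_precomp j'⟩
  have hsplit : ∀ k : C(K, ℝ), e (r k) + e' (r' k) = k := fun k => by
    ext y
    rw [ContinuousMap.add_apply]
    by_cases hy : y ∈ Set.range j
    · rw [he0' _ y (by rw [hrange']; exact not_not.2 hy), add_zero]
      obtain ⟨x, rfl⟩ := hy
      exact he _ x
    · rw [he0 _ y hy, zero_add]
      have hy' : y ∈ Set.range j' := by rw [hrange']; exact hy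
      obtain ⟨x, rfl⟩ := hy'
      exact he' _ x
  obtain ⟨x, u, hxU, hux, hu, hud⟩ := exists_disjoint_bumps (hU.preimage hj.continuous) ⟨a, ha⟩
  have hf1 : ∀ y, |f y| ≤ 1 := fun y => (f.norm_coe_le_norm y).trans hf
  -- On `K_i`, `f + w n = (1 - u n) f + u n` is a pointwise convex combination of `f` and `1`: it
  -- stays in the unit ball and equals `1` at `x n`.
  let w : ℕ → C(X i, ℝ) := fun n => u n * (1 - f.comp j)
  have hwapply : ∀ n y, w n y = u n y * (1 - f (j y)) := fun _ _ => rfl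
  have hw : ∀ n y, |w n y| ≤ 2 := fun n y => by
    have h1 := abs_le.1 (hf1 (j y))
    have h2 := hu n y
    rw [hwapply, abs_mul, abs_of_nonneg h2.1, abs_of_nonneg (by linarith)]
    nlinarith [h2.1, h2.2]
  have hd : ∀ n m y, n ≠ m → w n y = 0 ∨ w m y = 0 := fun n m y hnm => by
    rw [hwapply, hwapply]
    exact (hud n m y hnm).imp (fun h => by rw [h, zero_mul]) fun h => by rw [h, zero_mul]
  let R : C(X i, ℝ) →L[ℝ] C(X i, ℝ) := r.comp (T.comp e)
  let A : C(X i, ℝ) →L[ℝ] C(c.coPiece i, ℝ) := r'.comp (T.comp e)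
  let B : C(c.coPiece i, ℝ) →L[ℝ] C(X i, ℝ) := r.comp (T.comp e')
  obtain ⟨q, hq, hRq⟩ := (hX i R).sq_apply zero_le_two hw hd x
  have hBA := tendsto_comp_apply_of_isWeaklyCompactOperator A B
    ((hc i).imp (fun h => h A) fun h => h B) zero_le_two hw hd x
  have hlim := hq.add hBA
  rw [add_zero] at hlim
  obtain ⟨n, hn⟩ := (hlim.eventually (lt_mem_nhds (neg_lt_zero.2 hε))).exists
  refine ⟨j (x n), hxU n, e (w n), ?_, ?_, ?_⟩
  · rw [ContinuousMap.norm_le _ zero_le_one]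
    intro y
    rw [ContinuousMap.add_apply, Real.norm_eq_abs]
    by_cases hy : y ∈ Set.range j
    · obtain ⟨z, rfl⟩ := hy
      have h1 := abs_le.1 (hf1 (j z))
      have h2 := hu n z
      rw [show e (w n) (j z) = w n z from he _ z, hwapply, abs_le]
      constructor <;> nlinarith [h2.1, h2.2]
    · rw [he0 _ y hy, add_zero]
      exact hf1 y
  · rw [show e (w n) (j (x n)) = w n (x n) from he _ _, hwapply, hux]
    ring
  · obtain ⟨C, hC, hRC⟩ := hRq n
    -- Split the intermediate function `T (e (w n))` into its parts on `K_i` and on `K_{-i}`.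
    have h1 : T.comp T (e (w n)) (j (x n)) = R (R (w n)) (x n) + B (A (w n)) (x n) := by
      have := congrArg (fun k => T k (j (x n))) (hsplit (T (e (w n))))
      simp only [map_add, ContinuousMap.add_apply] at this
      exact this.symm
    have h2 : 0 ≤ w n (x n) := by
      rw [hwapply, hux, one_mul]
      linarith [(abs_le.1 (hf1 (j (x n)))).2]
    rw [h1, hRC]
    nlinarith [mul_nonneg hC h2]
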